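/- Let $\mathcal H$ be a separable infinite-dimensional complex Hilbert space. A bounded operator $T$ is called quasinilpotent if $\sigma(T)=\{0\}$; for such $T$ and $x\neq 0$ put $$k_x(T)=\limsup_{\lambda\to 0}\frac{\ln\|(\lambda-T)^{-1}x\|}{\ln\|(\lambda-T)^{-1}\|},\qquad \Lambda(T)=\{k_x(T):x\neq 0\}.$$ There exist an orthonormal basis $\{e_n\}_{n\ge 0}$ of $\mathcal H$, a bounded operator $A$ on $\mathcal H$ with $Ae_n=\frac{1}{n+1}e_{n+1}$ for all $n\ge 0$, and an enumeration $\{r_k\}_{k\ge 1}$ without repetition of the rational numbers in $(0,1]$, such that the operators $A_k=r_kA$ have the following properties. Each $A_k$ is quasinilpotent with $\Lambda(A_k)=\{1\}$; the norms $\|A_k\|$ are bounded, and the direct sum $\bigoplus_{k=1}^\infty A_k$, acting coordinatewise on the Hilbert space direct sum $\mathcal K=\bigoplus_{k=1}^\infty\mathcal H$, is quasinilpotent with $\Lambda\big(\bigoplus_{k=1}^\infty A_k\big)=(0,1]$. Consequently $$\Lambda\Big(\bigoplus_{k=1}^\infty A_k\Big)\supsetneq\overline{\bigcup_{k=1}^\infty\Lambda(A_k)}.$$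 -/

import Mathlib

open Filter Topology

noncomputable section

/-- A bounded operator is quasinilpotent if its spectrum is `{0}`. -/
def IsQuasinilpotent {E : Type*} [NormedAddCommGroup E] [InnerProductSpace ℂ E]
    (T : E →L[ℂ] E) : Prop :=
  spectrum ℂ T = {0}

/-- `k_x(T) = limsup_{z → 0} ln ‖(z - T)⁻¹ x‖ / ln ‖(z - T)⁻¹‖`, with `z → 0` through nonzero
complex numbers. For quasinilpotent `T` and `x ≠ 0` on a Hilbert space, every `z ≠ 0` lies in the
resolvent set, the denominator tends to `+∞`, and the quotient is bounded near `0` because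
`‖x‖ / (|z| + ‖T‖) ≤ ‖(z - T)⁻¹ x‖ ≤ ‖(z - T)⁻¹‖ ‖x‖`, so the real `limsup` is the usual one. -/
def localPower {E : Type*} [NormedAddCommGroup E] [InnerProductSpace ℂ E]
    (T : E →L[ℂ] E) (x : E) : ℝ :=
  limsup (fun z : ℂ => Real.log ‖resolvent T z x‖ / Real.log ‖resolvent T z‖) (𝓝[≠] 0)

/-- The power set `Λ(T) = {k_x(T) : x ≠ 0}`. -/
def operatorPowerSet {E : Type*} [NormedAddCommGroup E] [InnerProductSpace ℂ E]
    (T : E →L[ℂ] E) : Set ℝ :=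
  {t | ∃ x : E, x ≠ 0 ∧ localPower T x = t}

/-- The direct sum of a uniformly bounded sequence of operators on `H`, acting coordinatewise on
the Hilbert space direct sum of countably many copies of `H`. -/
def directSumOperator {H : Type*} [NormedAddCommGroup H] [InnerProductSpace ℂ H]
    (B : ℕ → H →L[ℂ] H) (hB : BddAbove (Set.range fun k => ‖B k‖)) :
    lp (fun _ : ℕ => H) 2 →L[ℂ] lp (fun _ : ℕ => H) 2 :=
  lp.mapCLM 2 B (K := ⨆ k, ‖B k‖) (Real.iSup_nonneg fun k => norm_nonneg (B k))
    (fun k => le_ciSup hB k)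

end

/-! ### Growth estimates -/

/-! Everything is measured by the limit or limsup of `‖z‖ * log ‖·‖` at `0`. Since `‖A ^ n‖ ≤ 1 /
n!`, the resolvent of `r A` is at most `‖z‖⁻¹ exp (r / ‖z‖)`. Conversely, with `z = r u`, the `n`-th
coordinate of `(z - r A)⁻¹ x` is a polynomial in `u` divided by `n! r u ^ (n + 1)`
(`inner_mul_eq_sum`). For `n = ⌊1 / ‖u‖⌋` the denominator is so small that it yields the factor `exp
(1 / ‖u‖)`, and the maximum modulus principle finds on each small circle a point where the
polynomial is at least its lowest term. So every `x ≠ 0` has rate `r`, the rate of the resolvent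
itself, and the power set of `r A` is `{1}`.

In the direct sum the resolvent has rate `1`, because some `r_k = 1`, while `x` has rate `sup {r_k :
x_k ≠ 0}` (`localPower_directSumOperator`). By density of the rationals these suprema fill `(0, 1]`.
-/

theorem Nat.factorial_le_pow_mul_exp {n : ℕ} (hn : 1 ≤ n) :
    (n.factorial : ℝ) ≤ (n : ℝ) ^ (n + 1) * Real.exp (1 - n) := by
  induction n, hn using Nat.le_induction with
  | base => simp
  | succ n hn ih =>
    have hn0 : (0 : ℝ) < n := by exact_mod_cast hn
    -- The inductive step amounts to `e ≤ (1 + 1 / n) ^ (n + 1)`, which follows from `log x ≥ 1 - 1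
    -- / x`.
    have key : Real.exp 1 * (n : ℝ) ^ (n + 1) ≤ ((n : ℝ) + 1) ^ (n + 1) := by
      have h1 : (1 : ℝ) ≤ (n + 1) * Real.log ((n + 1) / n) := by
        have h := Real.one_sub_inv_le_log_of_pos (x := ((n : ℝ) + 1) / n) (by positivity)
        have h2 : 1 - (((n : ℝ) + 1) / n)⁻¹ = 1 / (n + 1) := by field_simp; ring
        rw [h2, div_le_iff₀ (by positivity)] at h
        linarith
      have h3 : Real.exp 1 ≤ (((n : ℝ) + 1) / n) ^ (n + 1) := by
        rw [← Real.log_le_log_iff (Real.exp_pos 1) (by positivity), Real.log_exp, Real.log_pow]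
        push_cast
        exact h1
      rwa [div_pow, le_div_iff₀ (by positivity)] at h3
    have hexp : Real.exp (1 - n) = Real.exp 1 * Real.exp (1 - ((n + 1 : ℕ) : ℝ)) := by
      rw [← Real.exp_add]; push_cast; ring_nf
    rw [Nat.factorial_succ]
    push_cast at hexp ⊢
    calc ((n : ℝ) + 1) * n.factorial
        ≤ (n + 1) * ((n : ℝ) ^ (n + 1) * Real.exp (1 - n)) := by gcongr
      _ = (n + 1) * (Real.exp 1 * (n : ℝ) ^ (n + 1)) * Real.exp (1 - (n + 1)) := by
        rw [hexp]; ring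
      _ ≤ (n + 1) * ((n : ℝ) + 1) ^ (n + 1) * Real.exp (1 - (n + 1)) := by gcongr
      _ = _ := by ring

/-- The term of index `⌊a⌋` in the exponential series is, up to a factor of order `a`,
as large as the whole series. -/
theorem Real.exp_sub_two_div_le_pow_floor_div_factorial {a : ℝ} (ha : 1 ≤ a) :
    Real.exp (a - 2) / a ≤ a ^ ⌊a⌋₊ / (⌊a⌋₊).factorial := by
  set n := ⌊a⌋₊ with hn
  have hn1 : 1 ≤ n := Nat.le_floor (by simpa using ha)
  have hna : (n : ℝ) ≤ a := Nat.floor_le (by linarith)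
  have han : a < n + 1 := Nat.lt_floor_add_one a
  have hn0 : (0 : ℝ) < n := by exact_mod_cast hn1
  have ha0 : 0 < a := by linarith
  rw [div_le_div_iff₀ ha0 (by positivity)]
  -- As `a < n + 1`, the shift by `2` gives `exp (a - 2) ≤ exp (n - 1)`, which cancels the
  -- exponential in the factorial bound.
  calc Real.exp (a - 2) * n.factorial
      ≤ Real.exp (n - 1) * ((n : ℝ) ^ (n + 1) * Real.exp (1 - n)) := by
        refine mul_le_mul (Real.exp_le_exp.2 (by linarith)) (Nat.factorial_le_pow_mul_exp hn1)
          (by positivity) (by positivity)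
    _ = (n : ℝ) ^ n * n * (Real.exp (n - 1) * Real.exp (1 - n)) := by ring
    _ = (n : ℝ) ^ n * n := by rw [← Real.exp_add]; simp
    _ ≤ a ^ n * a := by gcongr

/-- Constants and powers of `ρ` do not affect the exponential rate, since `ρ log ρ → 0`. -/
theorem Real.tendsto_mul_log_mul_zpow_mul_exp {C : ℝ} (hC : 0 < C) (m : ℤ) (t : ℝ) :
    Tendsto (fun ρ : ℝ => ρ * Real.log (C * ρ ^ m * Real.exp (t / ρ))) (𝓝[>] 0) (𝓝 t) := by
  have h1 : Tendsto (fun ρ : ℝ => Real.log ρ * ρ) (𝓝[>] 0) (𝓝 0) := by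
    simpa using tendsto_log_mul_rpow_nhdsGT_zero zero_lt_one
  have h2 : Tendsto (fun ρ : ℝ => ρ * Real.log C) (𝓝[>] 0) (𝓝 0) := by
    have : Tendsto (fun ρ : ℝ => ρ * Real.log C) (𝓝 0) (𝓝 (0 * Real.log C)) :=
      tendsto_id.mul_const _
    rw [zero_mul] at this
    exact this.mono_left nhdsWithin_le_nhds
  have h3 := (h2.add (h1.const_mul (m : ℝ))).add_const t
  simp only [mul_zero, zero_add] at h3
  refine h3.congr' ?_
  filter_upwards [self_mem_nhdsWithin] with ρ hρ
  have hρ : 0 < ρ := hρ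
  rw [Real.log_mul (by positivity) (by positivity), Real.log_mul (by positivity) (by positivity),
    Real.log_exp, Real.log_zpow]
  field_simp

theorem frequently_nhdsNE_zero_of_norm {p : ℂ → Prop}
    (h : ∀ᶠ ρ : ℝ in 𝓝[>] 0, ∃ z : ℂ, ‖z‖ = ρ ∧ p z) : ∃ᶠ z in 𝓝[≠] (0 : ℂ), p z := by
  intro hn
  rw [eventually_nhdsWithin_iff, Metric.eventually_nhds_iff] at hn
  obtain ⟨δ, hδ, hn⟩ := hn
  have hlt : ∀ᶠ ρ : ℝ in 𝓝[>] 0, ρ < δ := nhdsWithin_le_nhds (Iio_mem_nhds hδ)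
  obtain ⟨ρ, ⟨⟨z, hz, hp⟩, hρ⟩, hpos⟩ := ((h.and hlt).and self_mem_nhdsWithin).exists
  have hpos : 0 < ρ := hpos
  refine hn (y := z) (by simpa [hz] using hρ) ?_ hp
  have : 0 < ‖z‖ := hz ▸ hpos
  simpa using this

/-! ### Resolvents of elements whose powers decay factorially -/

section BanachAlgebra

variable {R : Type*} [NormedRing R] [NormedAlgebra ℂ R] [CompleteSpace R] {a : R} {r : ℝ}

/-- The Neumann series in `z⁻¹ • a` is dominated termwise by the exponential series of `r / ‖z‖`, so
it converges for every `z ≠ 0`. -/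
theorem isUnit_and_norm_resolvent_le_of_norm_pow_le
    (ha : ∀ n : ℕ, ‖a ^ n‖ ≤ r ^ n / n.factorial) {z : ℂ} (hz : z ≠ 0) :
    IsUnit (algebraMap ℂ R z - a) ∧ ‖resolvent a z‖ ≤ ‖z‖⁻¹ * Real.exp (r / ‖z‖) := by
  have hzn : 0 < ‖z‖ := norm_pos_iff.2 hz
  have hb : ∀ n : ℕ, ‖(z⁻¹ • a) ^ n‖ ≤ (r / ‖z‖) ^ n / n.factorial := fun n => by
    rw [smul_pow, norm_smul, norm_pow, norm_inv, div_pow]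
    calc (‖z‖⁻¹) ^ n * ‖a ^ n‖ ≤ (‖z‖⁻¹) ^ n * (r ^ n / n.factorial) := by
          gcongr; exact ha n
      _ = _ := by rw [inv_pow]; field_simp
  have hexp : HasSum (fun n : ℕ => (r / ‖z‖) ^ n / n.factorial) (Real.exp (r / ‖z‖)) := by
    rw [Real.exp_eq_exp_ℝ]; exact NormedSpace.expSeries_div_hasSum_exp _
  have hs : Summable ((z⁻¹ • a) ^ · : ℕ → R) := Summable.of_norm_bounded hexp.summable hb
  have hfac : algebraMap ℂ R z - a = z • (1 - z⁻¹ • a) := by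
    rw [smul_sub, smul_smul, mul_inv_cancel₀ hz, one_smul, Algebra.algebraMap_eq_smul_one]
  have hl : (z⁻¹ • ∑' n : ℕ, (z⁻¹ • a) ^ n) * (algebraMap ℂ R z - a) = 1 := by
    rw [hfac, smul_mul_smul_comm, hs.tsum_pow_mul_one_sub, inv_mul_cancel₀ hz, one_smul]
  have hr : (algebraMap ℂ R z - a) * (z⁻¹ • ∑' n : ℕ, (z⁻¹ • a) ^ n) = 1 := by
    rw [hfac, smul_mul_smul_comm, hs.one_sub_mul_tsum_pow, mul_inv_cancel₀ hz, one_smul]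
  let u : Rˣ := ⟨_, _, hr, hl⟩
  refine ⟨u.isUnit, ?_⟩
  have hres : resolvent a z = z⁻¹ • ∑' n : ℕ, (z⁻¹ • a) ^ n := Ring.inverse_unit u
  rw [hres, norm_smul, norm_inv]
  gcongr
  exact tsum_of_norm_bounded hexp hb

theorem spectrum_eq_singleton_zero_of_norm_pow_le [Nontrivial R]
    (ha : ∀ n : ℕ, ‖a ^ n‖ ≤ r ^ n / n.factorial) : spectrum ℂ a = {0} := by
  refine (spectrum.nonempty a).subset_singleton_iff.1 fun z hz => ?_
  by_contra h
  exact hz (isUnit_and_norm_resolvent_le_of_norm_pow_le ha h).1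

end BanachAlgebra

section ResolventApply

variable {E : Type*} [NormedAddCommGroup E] [NormedSpace ℂ E] {T : E →L[ℂ] E} {z : ℂ}

theorem smul_resolvent_apply_sub (h : IsUnit (algebraMap ℂ (E →L[ℂ] E) z - T)) (x : E) :
    z • resolvent T z x - T (resolvent T z x) = x := by
  have := congrArg (fun S : E →L[ℂ] E => S x) (Ring.mul_inverse_cancel _ h)
  simpa [resolvent, Algebra.algebraMap_eq_smul_one] using this

theorem eq_resolvent_apply (h : IsUnit (algebraMap ℂ (E →L[ℂ] E) z - T)) {x y : E}
    (hy : z • y - T y = x) : y = resolvent T z x := by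
  have := congrArg (fun S : E →L[ℂ] E => S y) (Ring.inverse_mul_cancel _ h)
  rw [← hy]
  simpa [resolvent, Algebra.algebraMap_eq_smul_one] using this.symm

end ResolventApply

/-! ### Computing the local power from growth rates -/

section LocalPower

variable {E : Type*} [NormedAddCommGroup E] [InnerProductSpace ℂ E] {T : E →L[ℂ] E}

/-- A limsup needs the upper bound at all `z` near `0` but the lower bound only frequently; the
denominator needs a true limit. -/
theorem localPower_eq_div {x : E} {s t C : ℝ} (hs : 0 < s) (ht : 0 < t) (hC : 0 < C)
    (hden : Tendsto (fun z : ℂ => ‖z‖ * Real.log ‖resolvent T z‖) (𝓝[≠] 0) (𝓝 s))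
    (hup : ∀ᶠ z : ℂ in 𝓝[≠] 0,
      ‖resolvent T z x‖ ≤ C * ‖z‖ ^ (-1 : ℤ) * Real.exp (t / ‖z‖))
    (hlow : ∀ q < t, ∃ᶠ z : ℂ in 𝓝[≠] 0, q < ‖z‖ * Real.log ‖resolvent T z x‖) :
    localPower T x = t / s := by
  have hpos : ∀ᶠ z : ℂ in 𝓝[≠] 0, 0 < ‖z‖ * Real.log ‖resolvent T z‖ :=
    hden.eventually (lt_mem_nhds hs)
  have hne : ∀ᶠ z : ℂ in 𝓝[≠] 0, 0 < ‖z‖ := by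
    filter_upwards [self_mem_nhdsWithin] with z hz using norm_pos_iff.2 hz
  have hquot : ∀ {z : ℂ}, 0 < ‖z‖ → Real.log ‖resolvent T z x‖ / Real.log ‖resolvent T z‖ =
      (‖z‖ * Real.log ‖resolvent T z x‖) / (‖z‖ * Real.log ‖resolvent T z‖) :=
    fun hz => (mul_div_mul_left _ _ hz.ne').symm
  have hg := (Real.tendsto_mul_log_mul_zpow_mul_exp hC (-1) t).comp
    (tendsto_norm_nhdsNE_zero (E := ℂ))
  have hupper : ∀ y > t / s, ∀ᶠ z : ℂ in 𝓝[≠] 0,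
      Real.log ‖resolvent T z x‖ / Real.log ‖resolvent T z‖ < y := by
    intro y hy
    filter_upwards [hpos, hne, hup, hg.eventually (lt_mem_nhds ht),
      (hg.div hden hs.ne').eventually (gt_mem_nhds hy)] with z h1 h2 h3 h4 h5
    rw [hquot h2]
    refine lt_of_le_of_lt ?_ h5
    refine div_le_div_of_nonneg_right ?_ h1.le
    -- If the vector vanishes, `Real.log 0 = 0` is still below the comparison function, which is
    -- eventually positive because `t > 0`.
    rcases (norm_nonneg (resolvent T z x)).eq_or_lt with h0 | h0
    · rw [← h0, Real.log_zero, mul_zero]; exact h4.le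
    · exact mul_le_mul_of_nonneg_left (Real.log_le_log h0 h3) h2.le
  have hlower : ∀ y < t / s, ∃ᶠ z : ℂ in 𝓝[≠] 0,
      y < Real.log ‖resolvent T z x‖ / Real.log ‖resolvent T z‖ := by
    intro y hy
    obtain ⟨q, hq1, hq2⟩ := exists_between ((lt_div_iff₀ hs).1 hy)
    have hev := (hden.const_mul y).eventually (gt_mem_nhds hq1)
    refine ((hlow q hq2).and_eventually (hpos.and (hne.and hev))).mono ?_
    rintro z ⟨h1, h2, h3, h4⟩
    rw [hquot h3, lt_div_iff₀ h2]
    exact h4.trans h1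
  have hbdd : IsBoundedUnder (· ≤ ·) (𝓝[≠] (0 : ℂ))
      (fun z : ℂ => Real.log ‖resolvent T z x‖ / Real.log ‖resolvent T z‖) :=
    ⟨t / s + 1, eventually_map.2 ((hupper _ (lt_add_one _)).mono fun _ h => h.le)⟩
  have hcobdd : IsCoboundedUnder (· ≤ ·) (𝓝[≠] (0 : ℂ))
      (fun z : ℂ => Real.log ‖resolvent T z x‖ / Real.log ‖resolvent T z‖) :=
    IsCoboundedUnder.of_frequently_ge
      ((hlower (t / s - 1) (sub_one_lt _)).mono fun _ h => h.le)
  exact le_antisymm ((limsup_le_iff hcobdd hbdd).2 hupper) ((le_limsup_iff hcobdd hbdd).2 hlower)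

theorem tendsto_norm_mul_log_norm_resolvent {t c : ℝ} (hc : 0 < c)
    (hup : ∀ z : ℂ, z ≠ 0 → ‖resolvent T z‖ ≤ ‖z‖⁻¹ * Real.exp (t / ‖z‖))
    (hlow : ∀ᶠ z : ℂ in 𝓝[≠] 0, c * Real.exp (t / ‖z‖) ≤ ‖resolvent T z‖) :
    Tendsto (fun z : ℂ => ‖z‖ * Real.log ‖resolvent T z‖) (𝓝[≠] 0) (𝓝 t) := by
  have h1 := (Real.tendsto_mul_log_mul_zpow_mul_exp one_pos (-1) t).comp
    (tendsto_norm_nhdsNE_zero (E := ℂ))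
  have h2 := (Real.tendsto_mul_log_mul_zpow_mul_exp hc 0 t).comp
    (tendsto_norm_nhdsNE_zero (E := ℂ))
  refine tendsto_of_tendsto_of_tendsto_of_le_of_le' h2 h1 ?_ ?_
  · filter_upwards [hlow] with z hz
    simp only [Function.comp, zpow_zero, mul_one]
    gcongr
  · filter_upwards [hlow, self_mem_nhdsWithin] with z hz hz0
    have : 0 < ‖resolvent T z‖ := lt_of_lt_of_le (by positivity) hz
    simp only [Function.comp, zpow_neg_one, one_mul]
    gcongr
    exact hup z hz0

end LocalPower

/-! ### The weighted shift -/

/-- A polynomial takes on each circle centred at `0` a value at least as large as its lowest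
nonzero term. -/
theorem Complex.exists_norm_eq_norm_sum_ge {a : ℕ → ℂ} {m n : ℕ} (hmn : m ≤ n)
    (ha : ∀ j < m, a j = 0) {ρ : ℝ} (hρ : 0 < ρ) :
    ∃ u : ℂ, ‖u‖ = ρ ∧ ‖a m‖ * ρ ^ m ≤ ‖∑ j ∈ Finset.range (n + 1), a j * u ^ j‖ := by
  -- `Q` is the polynomial divided by `u ^ m`, so `Q 0 = a m`. Truncated subtraction is harmless, as
  -- the coefficients below `m` vanish.
  let Q : ℂ → ℂ := fun u => ∑ j ∈ Finset.range (n + 1), a j * u ^ (j - m)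
  have hQ : Differentiable ℂ Q := by fun_prop
  obtain ⟨u, hu, hmax⟩ := Complex.exists_mem_frontier_isMaxOn_norm
    (Metric.isBounded_ball (x := (0 : ℂ)) (r := ρ)) ⟨0, Metric.mem_ball_self hρ⟩ hQ.diffContOnCl
  rw [frontier_ball _ hρ.ne', mem_sphere_zero_iff_norm] at hu
  have h0 : Q 0 = a m := by
    simp only [Q]
    rw [Finset.sum_eq_single m]
    · simp
    · intro j _ hj
      rcases lt_or_gt_of_ne hj with h | h
      · simp [ha j h]
      · simp [(Nat.sub_pos_of_lt h).ne']
    · intro h; simp at h; omega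
  have hle : ‖Q 0‖ ≤ ‖Q u‖ := hmax (subset_closure (Metric.mem_ball_self hρ))
  have hfac : ∑ j ∈ Finset.range (n + 1), a j * u ^ j = Q u * u ^ m := by
    simp only [Q, Finset.sum_mul]
    refine Finset.sum_congr rfl fun j _ => ?_
    rcases lt_or_ge j m with h | h
    · simp [ha j h]
    · rw [mul_assoc, ← pow_add, Nat.sub_add_cancel h]
  refine ⟨u, hu, ?_⟩
  rw [hfac, norm_mul, norm_pow, hu, ← h0]
  gcongr

/-- Distinct basis vectors are at distance at least `1`, so the balls of radius `1 / 2` around them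
are disjoint and separability makes the basis countable. -/
theorem exists_hilbertBasis_nat {H : Type*} [NormedAddCommGroup H] [InnerProductSpace ℂ H]
    [CompleteSpace H] [TopologicalSpace.SeparableSpace H] (hH : ¬ FiniteDimensional ℂ H) :
    Nonempty (HilbertBasis ℕ ℂ H) := by
  obtain ⟨w, b, -⟩ := exists_hilbertBasis ℂ H
  have hdist : ∀ i j, i ≠ j → 1 ≤ dist (b i) (b j) := fun i j hij => by
    have h := norm_sub_sq (𝕜 := ℂ) (b i) (b j)
    rw [b.orthonormal.inner_eq_zero hij, b.orthonormal.norm_eq_one, b.orthonormal.norm_eq_one] at h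
    rw [dist_eq_norm]
    norm_num at h
    nlinarith [norm_nonneg (b i - b j)]
  have hcount : Countable w := by
    refine Pairwise.countable_of_isOpen_disjoint (s := fun i => Metric.ball (b i) (1 / 2))
      (fun i j hij => Metric.ball_disjoint_ball ?_) (fun _ => Metric.isOpen_ball)
      (fun i => ⟨b i, Metric.mem_ball_self (by norm_num)⟩)
    linarith [hdist i j hij]
  have hinf : Infinite w := by
    by_contra hfin
    rw [not_infinite_iff_finite] at hfin
    have := Fintype.ofFinite w
    exact hH b.toOrthonormalBasis.toBasis.finiteDimensional_of_finite
  obtain ⟨f⟩ := nonempty_equiv_of_countable (α := ℕ) (β := w)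
  refine ⟨HilbertBasis.mk (v := b ∘ f) (b.orthonormal.comp f f.injective) ?_⟩
  rw [f.surjective.range_comp, b.dense_span]

section WeightedShift

variable {H : Type*} [NormedAddCommGroup H] [InnerProductSpace ℂ H]

theorem HilbertBasis.continuousLinearMap_ext {F : Type*} [NormedAddCommGroup F] [NormedSpace ℂ F]
    {ι : Type*} (e : HilbertBasis ι ℂ H) {S T : H →L[ℂ] F} (h : ∀ n, S (e n) = T (e n)) :
    S = T := by
  refine ContinuousLinearMap.ext_on (s := Set.range e) ?_ ?_
  · rw [Submodule.dense_iff_topologicalClosure_eq_top, e.dense_span]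
  · rintro _ ⟨n, rfl⟩; exact h n

theorem HilbertBasis.exists_weighted_shift [CompleteSpace H] (e : HilbertBasis ℕ ℂ H) (n : ℕ)
    {w : ℕ → ℂ} {K : ℝ} (hK : 0 ≤ K) (hw : ∀ m, ‖w m‖ ≤ K) :
    ∃ W : H →L[ℂ] H, (∀ m, W (e m) = w m • e (m + n)) ∧ ‖W‖ ≤ K := by
  have hv : Orthonormal ℂ fun m => e (m + n) := e.orthonormal.comp _ (add_left_injective n)
  let S := hv.orthogonalFamily.linearIsometry
  let D := lp.mapCLM (E := fun _ : ℕ => ℂ) (F := fun _ : ℕ => ℂ) 2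
    (fun m => w m • ContinuousLinearMap.id ℂ ℂ) (K := K) hK
    (fun m => by simpa [norm_smul] using hw m)
  refine ⟨S.toContinuousLinearMap ∘L D ∘L
    (e.repr.toLinearIsometry.toContinuousLinearMap), fun m => ?_, ?_⟩
  · have hD : D (lp.single 2 m (1 : ℂ)) = lp.single 2 m (w m) := by
      ext j
      change w j * (lp.single (E := fun _ : ℕ => ℂ) 2 m (1 : ℂ) j) = _
      by_cases h : j = m
      · subst h; simp
      · simp [h]
    simp only [ContinuousLinearMap.comp_apply, LinearIsometry.coe_toContinuousLinearMap,
      LinearIsometryEquiv.coe_toLinearIsometry, HilbertBasis.repr_self, hD]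
    simp [S, OrthogonalFamily.linearIsometry_apply_single]
  · refine ContinuousLinearMap.opNorm_le_bound _ hK fun x => ?_
    simp only [ContinuousLinearMap.comp_apply, LinearIsometry.coe_toContinuousLinearMap,
      LinearIsometry.norm_map, LinearIsometryEquiv.coe_toLinearIsometry]
    refine (D.le_of_opNorm_le (lp.norm_mapCLM_le ..) _).trans ?_
    simp

/-- The operator `A` is the shift with weights `1, 1/2, 1/3, …` in the basis `e`. -/
def IsHarmonicShift (e : HilbertBasis ℕ ℂ H) (A : H →L[ℂ] H) : Prop :=
  ∀ n : ℕ, A (e n) = (1 / ((n : ℂ) + 1)) • e (n + 1)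

theorem exists_isHarmonicShift [CompleteSpace H] (e : HilbertBasis ℕ ℂ H) :
    ∃ A : H →L[ℂ] H, IsHarmonicShift e A := by
  obtain ⟨A, hA, -⟩ := e.exists_weighted_shift 1 (w := fun n => 1 / ((n : ℂ) + 1)) zero_le_one
    fun m => by
      have : ‖(m : ℂ) + 1‖ = m + 1 := by exact_mod_cast Complex.norm_natCast (m + 1)
      rw [norm_div, norm_one, this]
      exact div_le_one_of_le₀ (by linarith [m.cast_nonneg (α := ℝ)]) (by positivity)
  exact ⟨A, hA⟩

namespace IsHarmonicShift

variable {e : HilbertBasis ℕ ℂ H} {A : H →L[ℂ] H}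

theorem pow_apply (hA : IsHarmonicShift e A) (n m : ℕ) :
    (A ^ n) (e m) = ((m.factorial : ℂ) / (m + n).factorial) • e (m + n) := by
  induction n with
  | zero => simp [div_self (Nat.cast_ne_zero.2 m.factorial_ne_zero : (m.factorial : ℂ) ≠ 0)]
  | succ n ih =>
    rw [pow_succ', mul_apply_eq_comp, ih, map_smul, hA, smul_smul, ← add_assoc,
      Nat.factorial_succ]
    congr 1
    push_cast
    rw [div_mul_div_comm, mul_one, mul_comm ((m : ℂ) + n + 1)]

theorem norm_pow_le [CompleteSpace H] (hA : IsHarmonicShift e A) (n : ℕ) :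
    ‖A ^ n‖ ≤ 1 / n.factorial := by
  obtain ⟨W, hW, hWn⟩ := e.exists_weighted_shift n
    (w := fun m => (m.factorial : ℂ) / (m + n).factorial) (K := 1 / n.factorial) (by positivity)
    fun m => by
      rw [norm_div, Complex.norm_natCast, Complex.norm_natCast,
        div_le_div_iff₀ (by positivity) (by positivity), one_mul]
      -- The weight `m! / (m + n)!` is at most `1 / n!` because binomial coefficients are positive
      -- integers.
      exact_mod_cast Nat.le_of_dvd (by positivity) (Nat.factorial_mul_factorial_dvd_factorial_add m n)
  have : A ^ n = W := e.continuousLinearMap_ext fun m => by rw [hA.pow_apply, hW]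
  rwa [this]

theorem norm_smul_pow_le [CompleteSpace H] (hA : IsHarmonicShift e A) {r : ℝ} (hr : 0 ≤ r)
    (n : ℕ) : ‖((r : ℂ) • A) ^ n‖ ≤ r ^ n / n.factorial := by
  rw [smul_pow, norm_smul, norm_pow, Complex.norm_real, Real.norm_of_nonneg hr, div_eq_mul_one_div]
  gcongr
  exact hA.norm_pow_le n

theorem inner_zero_apply (hA : IsHarmonicShift e A) (y : H) : inner ℂ (e 0) (A y) = 0 := by
  have : (innerSL ℂ (e 0)) ∘L A = 0 := e.continuousLinearMap_ext fun m => by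
    simp [hA m, e.orthonormal.inner_eq_zero (Nat.succ_ne_zero m).symm]
  simpa using congrArg (fun S : H →L[ℂ] ℂ => S y) this

theorem inner_succ_apply (hA : IsHarmonicShift e A) (n : ℕ) (y : H) :
    inner ℂ (e (n + 1)) (A y) = 1 / ((n : ℂ) + 1) * inner ℂ (e n) y := by
  have : (innerSL ℂ (e (n + 1))) ∘L A = (1 / ((n : ℂ) + 1)) • innerSL ℂ (e n) :=
    e.continuousLinearMap_ext fun m => by
      rcases eq_or_ne n m with rfl | h
      · simp [hA n, e.orthonormal.norm_eq_one]
      · simp [hA m, e.orthonormal.inner_eq_zero h,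
          e.orthonormal.inner_eq_zero (Nat.succ_injective.ne h)]
  simpa using congrArg (fun S : H →L[ℂ] ℂ => S y) this

/-- Coordinates of the solution `y` of `z y - r A y = x`, where `z = r u`. -/
theorem inner_mul_eq_sum (hA : IsHarmonicShift e A) {r u : ℂ} {x y : H}
    (h : (r * u) • y - (r • A) y = x) (n : ℕ) :
    inner ℂ (e n) y * (n.factorial * r * u ^ (n + 1)) =
      ∑ j ∈ Finset.range (n + 1), j.factorial * inner ℂ (e j) x * u ^ j := by
  induction n with
  | zero =>
    simp [← h, hA.inner_zero_apply]
    ring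
  | succ n ih =>
    have hn : (n : ℂ) + 1 ≠ 0 := Nat.cast_add_one_ne_zero n
    rw [Finset.sum_range_succ, ← ih]
    simp only [← h, inner_sub_right, inner_smul_right, hA.inner_succ_apply,
      FunLike.coe_smul, Pi.smul_apply, Nat.factorial_succ]
    push_cast
    field_simp
    ring

/-- A single coordinate suffices: at index `⌊1 / ‖u‖⌋` one has `n! ‖u‖ ^ (n + 1) ≤ exp (2 - 1 /
‖u‖)`. -/
theorem norm_solution_ge (hA : IsHarmonicShift e A) {r : ℝ} (hr : 0 < r) {u : ℂ} {x y : H}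
    (h : ((r : ℂ) * u) • y - ((r : ℂ) • A) y = x) (hu0 : 0 < ‖u‖) (hu1 : ‖u‖ ≤ 1) {c : ℝ}
    (hc : c ≤ ‖∑ j ∈ Finset.range (⌊1 / ‖u‖⌋₊ + 1), j.factorial * inner ℂ (e j) x * u ^ j‖) :
    c / r * Real.exp (1 / ‖u‖ - 2) ≤ ‖y‖ := by
  set n := ⌊1 / ‖u‖⌋₊ with hn
  have hcoord := congrArg norm (hA.inner_mul_eq_sum h n)
  have hy : ‖inner ℂ (e n) y‖ ≤ ‖y‖ := by
    simpa [e.orthonormal.norm_eq_one] using norm_inner_le_norm (𝕜 := ℂ) (e n) y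
  rw [norm_mul, norm_mul, norm_mul, norm_pow, Complex.norm_natCast, Complex.norm_real,
    Real.norm_of_nonneg hr.le] at hcoord
  have hfloor := Real.exp_sub_two_div_le_pow_floor_div_factorial ((one_le_div hu0).2 hu1)
  rw [← hn, div_le_div_iff₀ (by positivity) (by positivity)] at hfloor
  have hfloor' : Real.exp (1 / ‖u‖ - 2) * (n.factorial * ‖u‖ ^ (n + 1)) ≤ 1 := by
    calc Real.exp (1 / ‖u‖ - 2) * (n.factorial * ‖u‖ ^ (n + 1))
        = (Real.exp (1 / ‖u‖ - 2) * n.factorial) * ‖u‖ ^ (n + 1) := by ring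
      _ ≤ ((1 / ‖u‖) ^ n * (1 / ‖u‖)) * ‖u‖ ^ (n + 1) := by gcongr
      _ = 1 := by rw [← pow_succ, ← mul_pow, one_div_mul_cancel hu0.ne', one_pow]
  have hcy : c ≤ ‖y‖ * (n.factorial * r * ‖u‖ ^ (n + 1)) :=
    (hc.trans hcoord.ge).trans (by gcongr)
  rw [div_mul_eq_mul_div, div_le_iff₀ hr]
  calc c * Real.exp (1 / ‖u‖ - 2)
      ≤ ‖y‖ * (n.factorial * r * ‖u‖ ^ (n + 1)) * Real.exp (1 / ‖u‖ - 2) := by gcongr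
    _ = ‖y‖ * r * (Real.exp (1 / ‖u‖ - 2) * (n.factorial * ‖u‖ ^ (n + 1))) := by ring
    _ ≤ ‖y‖ * r * 1 := by gcongr
    _ = ‖y‖ * r := mul_one _

variable [CompleteSpace H]

theorem isUnit_smul (hA : IsHarmonicShift e A) {r : ℝ} (hr : 0 ≤ r) {z : ℂ} (hz : z ≠ 0) :
    IsUnit (algebraMap ℂ (H →L[ℂ] H) z - (r : ℂ) • A) :=
  (isUnit_and_norm_resolvent_le_of_norm_pow_le (hA.norm_smul_pow_le hr) hz).1

theorem norm_resolvent_smul_le (hA : IsHarmonicShift e A) {r : ℝ} (hr : 0 ≤ r) {z : ℂ}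
    (hz : z ≠ 0) : ‖resolvent ((r : ℂ) • A) z‖ ≤ ‖z‖⁻¹ * Real.exp (r / ‖z‖) :=
  (isUnit_and_norm_resolvent_le_of_norm_pow_le (hA.norm_smul_pow_le hr) hz).2

/-- For `x = e 0` the polynomial is the constant `1`, so the bound holds at every point of the
circle. -/
theorem norm_resolvent_smul_ge (hA : IsHarmonicShift e A) {r : ℝ} (hr : 0 < r) {z : ℂ}
    (hz : z ≠ 0) (hzr : ‖z‖ ≤ r) :
    Real.exp (-2) / r * Real.exp (r / ‖z‖) ≤ ‖resolvent ((r : ℂ) • A) z‖ := by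
  have hrC : (r : ℂ) ≠ 0 := by exact_mod_cast hr.ne'
  have hz0 : 0 < ‖z‖ := norm_pos_iff.2 hz
  have hun : ‖z / r‖ = ‖z‖ / r := by rw [norm_div, Complex.norm_real, Real.norm_of_nonneg hr.le]
  have h := smul_resolvent_apply_sub (hA.isUnit_smul hr.le hz) (e 0)
  have h' : ((r : ℂ) * (z / r)) • resolvent ((r : ℂ) • A) z (e 0)
      - ((r : ℂ) • A) (resolvent ((r : ℂ) • A) z (e 0)) = e 0 := by
    rwa [mul_div_cancel₀ _ hrC]
  have key := hA.norm_solution_ge hr h' (by rw [hun]; positivity)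
    (by rw [hun]; exact div_le_one_of_le₀ hzr hr.le) (c := 1) (by
      rw [Finset.sum_eq_single 0]
      · simp [e.orthonormal.norm_eq_one]
      · intro j _ hj; simp [e.orthonormal.inner_eq_zero hj]
      · simp)
  have hop : ‖resolvent ((r : ℂ) • A) z (e 0)‖ ≤ ‖resolvent ((r : ℂ) • A) z‖ := by
    simpa [e.orthonormal.norm_eq_one] using (resolvent ((r : ℂ) • A) z).le_opNorm (e 0)
  refine le_trans (le_of_eq ?_) (key.trans hop)
  rw [hun, one_div_div, sub_eq_add_neg, Real.exp_add]
  ring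

theorem tendsto_norm_mul_log_norm_resolvent_smul (hA : IsHarmonicShift e A) {r : ℝ} (hr : 0 < r) :
    Tendsto (fun z : ℂ => ‖z‖ * Real.log ‖resolvent ((r : ℂ) • A) z‖) (𝓝[≠] 0) (𝓝 r) := by
  refine tendsto_norm_mul_log_norm_resolvent (c := Real.exp (-2) / r) (by positivity)
    (fun z hz => hA.norm_resolvent_smul_le hr.le hz) ?_
  filter_upwards [self_mem_nhdsWithin,
    nhdsWithin_le_nhds (Metric.closedBall_mem_nhds (0 : ℂ) hr)] with z hz hzr
  exact hA.norm_resolvent_smul_ge hr hz (by simpa using hzr)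

/-- The lowest term comes from the first nonzero coordinate of `x`. Positivity of the norm is
recorded so that `log` can later be compared monotonically in the direct sum. -/
theorem frequently_lt_norm_mul_log_norm_resolvent_apply (hA : IsHarmonicShift e A) {r : ℝ}
    (hr : 0 < r) {x : H} (hx : x ≠ 0) {q : ℝ} (hq : q < r) :
    ∃ᶠ z : ℂ in 𝓝[≠] 0, 0 < ‖resolvent ((r : ℂ) • A) z x‖ ∧
      q < ‖z‖ * Real.log ‖resolvent ((r : ℂ) • A) z x‖ := by
  have hcoord : ∃ m, inner ℂ (e m) x ≠ 0 := by
    by_contra! h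
    refine hx (e.repr.injective ?_)
    ext m
    simp [e.repr_apply_apply, h m]
  classical
  let m := Nat.find hcoord
  have hm : inner ℂ (e m) x ≠ 0 := Nat.find_spec hcoord
  have hlt : ∀ j < m, inner ℂ (e j) x = 0 := fun j hj => not_not.1 (Nat.find_min hcoord hj)
  set c := ‖(m.factorial : ℂ) * inner ℂ (e m) x‖ with hc
  have hc0 : 0 < c := norm_pos_iff.2 (mul_ne_zero (by exact_mod_cast m.factorial_ne_zero) hm)
  have hrC : (r : ℂ) ≠ 0 := by exact_mod_cast hr.ne'
  have hCpos : 0 < c / r * (r ^ m)⁻¹ * Real.exp (-2) := by positivity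
  refine frequently_nhdsNE_zero_of_norm ?_
  -- This ensures `m ≤ ⌊r / ρ⌋`, so the lowest term lies in the truncated sum, and also `ρ / r ≤ 1`.
  have hsmall : ∀ᶠ ρ : ℝ in 𝓝[>] 0, ρ < r / (m + 1) :=
    nhdsWithin_le_nhds (Iio_mem_nhds (by positivity))
  filter_upwards [self_mem_nhdsWithin, hsmall,
    (Real.tendsto_mul_log_mul_zpow_mul_exp hCpos m r).eventually (lt_mem_nhds hq)]
    with ρ hρ hρm hρq
  have hρ : 0 < ρ := hρ
  have hρ' : 0 < ρ / r := by positivity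
  rw [lt_div_iff₀ (by positivity)] at hρm
  have hmfloor : m ≤ ⌊1 / (ρ / r)⌋₊ := by
    refine Nat.le_floor ?_
    rw [one_div_div, le_div_iff₀ hρ]
    nlinarith
  obtain ⟨u, hu, hsum⟩ := Complex.exists_norm_eq_norm_sum_ge
    (a := fun j => (j.factorial : ℂ) * inner ℂ (e j) x) hmfloor
    (fun j hj => by simp [hlt j hj]) hρ'
  have hu0 : 0 < ‖u‖ := hu ▸ hρ'
  have hz : (r : ℂ) * u ≠ 0 := mul_ne_zero hrC (norm_pos_iff.1 hu0)
  have hzn : ‖(r : ℂ) * u‖ = ρ := by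
    rw [norm_mul, hu, Complex.norm_real, Real.norm_of_nonneg hr.le, mul_div_cancel₀ _ hr.ne']
  rw [← hu] at hsum
  have key := hA.norm_solution_ge hr
    (smul_resolvent_apply_sub (hA.isUnit_smul hr.le hz) x) hu0
    (by rw [hu]; exact div_le_one_of_le₀ (by nlinarith [m.cast_nonneg (α := ℝ)]) hr.le)
    hsum
  have hform : c * ‖u‖ ^ m / r * Real.exp (1 / ‖u‖ - 2) =
      c / r * (r ^ m)⁻¹ * Real.exp (-2) * ρ ^ (m : ℤ) * Real.exp (r / ρ) := by
    rw [hu, one_div_div, sub_eq_add_neg, Real.exp_add, div_pow, zpow_natCast]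
    field_simp
  rw [← hc, hform] at key
  refine ⟨(r : ℂ) * u, hzn, lt_of_lt_of_le (by positivity) key, ?_⟩
  rw [hzn]
  refine hρq.trans_le ?_
  gcongr

end IsHarmonicShift

end WeightedShift

/-! ### Direct sums of multiples of the weighted shift -/

theorem lp.norm_le_mul_norm_of_forall_le {ι : Type*} {E F : ι → Type*}
    [∀ i, NormedAddCommGroup (E i)] [∀ i, NormedAddCommGroup (F i)] {x : lp E 2} {y : lp F 2}
    {K : ℝ} (hK : 0 ≤ K) (h : ∀ i, ‖y i‖ ≤ K * ‖x i‖) : ‖y‖ ≤ K * ‖x‖ := by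
  have h2 : 0 < (2 : ENNReal).toReal := by norm_num
  refine lp.norm_le_of_forall_sum_le h2 (by positivity) fun s => ?_
  rw [Real.mul_rpow hK (norm_nonneg _)]
  calc ∑ i ∈ s, ‖y i‖ ^ (2 : ENNReal).toReal
      ≤ ∑ i ∈ s, K ^ (2 : ENNReal).toReal * ‖x i‖ ^ (2 : ENNReal).toReal := by
        refine Finset.sum_le_sum fun i _ => ?_
        rw [← Real.mul_rpow hK (norm_nonneg _)]
        exact Real.rpow_le_rpow (norm_nonneg _) (h i) h2.le
    _ = K ^ (2 : ENNReal).toReal * ∑ i ∈ s, ‖x i‖ ^ (2 : ENNReal).toReal :=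
        (Finset.mul_sum ..).symm
    _ ≤ _ := by
        gcongr
        exact lp.sum_rpow_le_norm_rpow h2 x s

section DirectSum

variable {H : Type*} [NormedAddCommGroup H] [InnerProductSpace ℂ H]
  {B : ℕ → H →L[ℂ] H} {hB : BddAbove (Set.range fun k => ‖B k‖)}

theorem directSumOperator_apply (x : lp (fun _ : ℕ => H) 2) (k : ℕ) :
    directSumOperator B hB x k = B k (x k) :=
  rfl

theorem directSumOperator_pow_apply (n : ℕ) (x : lp (fun _ : ℕ => H) 2) (k : ℕ) :
    (directSumOperator B hB ^ n) x k = (B k ^ n) (x k) := by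
  induction n with
  | zero => simp
  | succ n ih => simp only [pow_succ', mul_apply_eq_comp, directSumOperator_apply, ih]

theorem norm_directSumOperator_pow_le {n : ℕ} {K : ℝ} (hK : 0 ≤ K) (h : ∀ k, ‖B k ^ n‖ ≤ K) :
    ‖directSumOperator B hB ^ n‖ ≤ K :=
  ContinuousLinearMap.opNorm_le_bound _ hK fun x =>
    lp.norm_le_mul_norm_of_forall_le hK fun k => by
      rw [directSumOperator_pow_apply]
      exact (B k ^ n).le_of_opNorm_le (h k) (x k)

theorem resolvent_directSumOperator_apply {z : ℂ}
    (h : IsUnit (algebraMap ℂ (lp (fun _ : ℕ => H) 2 →L[ℂ] _) z - directSumOperator B hB))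
    {k : ℕ} (hk : IsUnit (algebraMap ℂ (H →L[ℂ] H) z - B k)) (x : lp (fun _ : ℕ => H) 2) :
    resolvent (directSumOperator B hB) z x k = resolvent (B k) z (x k) := by
  refine eq_resolvent_apply hk ?_
  exact congrArg (fun y : lp (fun _ : ℕ => H) 2 => y k) (smul_resolvent_apply_sub h x)

theorem HilbertBasis.exists_lp_support_eq (e : HilbertBasis ℕ ℂ H) (S : Set ℕ) :
    ∃ x : lp (fun _ : ℕ => H) 2, {k | x k ≠ 0} = S := by
  classical
  let f : ℕ → H := fun k => if k ∈ S then ((1 / 2 : ℂ) ^ k) • e 0 else 0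
  have hf : Memℓp f 2 := by
    refine memℓp_gen ?_
    refine Summable.of_nonneg_of_le (fun k => by positivity) (fun k => ?_)
      (summable_geometric_of_lt_one (r := (1 / 4 : ℝ)) (by norm_num) (by norm_num))
    by_cases hk : k ∈ S
    · simp only [f, hk, if_true, norm_smul, e.orthonormal.norm_eq_one]
      norm_num [← pow_mul, mul_comm k 2]
      norm_num [pow_mul]
    · simp [f, hk]
  refine ⟨⟨f, hf⟩, ?_⟩
  ext k
  have h0 : e 0 ≠ 0 := e.orthonormal.ne_zero 0
  change f k ≠ 0 ↔ k ∈ S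
  by_cases hk : k ∈ S <;> simp [f, hk, h0]

namespace IsHarmonicShift

variable [CompleteSpace H] {e : HilbertBasis ℕ ℂ H} {A : H →L[ℂ] H} {ρ : ℕ → ℝ}

theorem isQuasinilpotent_smul (hA : IsHarmonicShift e A) {r : ℝ} (hr : 0 ≤ r) :
    IsQuasinilpotent ((r : ℂ) • A) :=
  have : Nontrivial H := ⟨⟨e 0, 0, e.orthonormal.ne_zero 0⟩⟩
  spectrum_eq_singleton_zero_of_norm_pow_le (hA.norm_smul_pow_le hr)

theorem operatorPowerSet_smul (hA : IsHarmonicShift e A) {r : ℝ} (hr : 0 < r) :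
    operatorPowerSet ((r : ℂ) • A) = {1} := by
  have hpow : ∀ x : H, x ≠ 0 → localPower ((r : ℂ) • A) x = 1 := fun x hx => by
    rw [localPower_eq_div hr hr (norm_pos_iff.2 hx)
      (hA.tendsto_norm_mul_log_norm_resolvent_smul hr) ?_ ?_, div_self hr.ne']
    · filter_upwards [self_mem_nhdsWithin] with z hz
      rw [zpow_neg_one, mul_assoc, mul_comm]
      exact ContinuousLinearMap.le_of_opNorm_le _ (hA.norm_resolvent_smul_le hr.le hz) x
    · exact fun q hq => (hA.frequently_lt_norm_mul_log_norm_resolvent_apply hr hx hq).mono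
        fun _ h => h.2
  ext t
  constructor
  · rintro ⟨x, hx, rfl⟩; exact hpow x hx
  · rintro rfl; exact ⟨e 0, e.orthonormal.ne_zero 0, hpow _ (e.orthonormal.ne_zero 0)⟩

theorem norm_directSumOperator_pow_le (hA : IsHarmonicShift e A) (hρ0 : ∀ k, 0 < ρ k)
    (hρ1 : ∀ k, ρ k ≤ 1) (hBρ : ∀ k, B k = (ρ k : ℂ) • A) (n : ℕ) :
    ‖directSumOperator B hB ^ n‖ ≤ 1 ^ n / n.factorial :=
  _root_.norm_directSumOperator_pow_le (by positivity) fun k => by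
    rw [hBρ]
    refine (hA.norm_smul_pow_le (hρ0 k).le n).trans ?_
    have := (hρ0 k).le
    gcongr
    exact hρ1 k

theorem isQuasinilpotent_directSumOperator (hA : IsHarmonicShift e A) (hρ0 : ∀ k, 0 < ρ k)
    (hρ1 : ∀ k, ρ k ≤ 1) (hBρ : ∀ k, B k = (ρ k : ℂ) • A) :
    IsQuasinilpotent (directSumOperator B hB) :=
  have : Nontrivial (lp (fun _ : ℕ => H) 2) :=
    ⟨⟨lp.single 2 0 (e 0), 0, fun h => e.orthonormal.ne_zero 0 (by
      simpa using congrArg (fun y : lp (fun _ : ℕ => H) 2 => y 0) h)⟩⟩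
  spectrum_eq_singleton_zero_of_norm_pow_le (hA.norm_directSumOperator_pow_le hρ0 hρ1 hBρ)

theorem resolvent_directSumOperator_apply (hA : IsHarmonicShift e A) (hρ0 : ∀ k, 0 < ρ k)
    (hρ1 : ∀ k, ρ k ≤ 1) (hBρ : ∀ k, B k = (ρ k : ℂ) • A) {z : ℂ} (hz : z ≠ 0)
    (x : lp (fun _ : ℕ => H) 2) (k : ℕ) :
    resolvent (directSumOperator B hB) z x k = resolvent ((ρ k : ℂ) • A) z (x k) := by
  rw [← hBρ]
  refine _root_.resolvent_directSumOperator_apply (isUnit_and_norm_resolvent_le_of_norm_pow_le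
    (hA.norm_directSumOperator_pow_le hρ0 hρ1 hBρ) hz).1 ?_ x
  rw [hBρ]
  exact hA.isUnit_smul (hρ0 k).le hz

/-- The lower bound comes from vectors supported in the summand with `ρ k = 1`. -/
theorem tendsto_norm_mul_log_norm_resolvent_directSumOperator (hA : IsHarmonicShift e A)
    (hρ0 : ∀ k, 0 < ρ k) (hρ1 : ∀ k, ρ k ≤ 1) (hBρ : ∀ k, B k = (ρ k : ℂ) • A)
    (hone : ∃ k, ρ k = 1) :
    Tendsto (fun z : ℂ => ‖z‖ * Real.log ‖resolvent (directSumOperator B hB) z‖)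
      (𝓝[≠] 0) (𝓝 1) := by
  obtain ⟨k, hk⟩ := hone
  refine tendsto_norm_mul_log_norm_resolvent (c := Real.exp (-2) / 1) (by positivity)
    (fun z hz => (isUnit_and_norm_resolvent_le_of_norm_pow_le
      (hA.norm_directSumOperator_pow_le hρ0 hρ1 hBρ) hz).2) ?_
  filter_upwards [self_mem_nhdsWithin,
    nhdsWithin_le_nhds (Metric.closedBall_mem_nhds (0 : ℂ) one_pos)] with z hz hz1
  refine (hA.norm_resolvent_smul_ge one_pos hz (by simpa using hz1)).trans ?_
  refine ContinuousLinearMap.opNorm_le_bound _ (norm_nonneg _) fun x => ?_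
  have hcoord := hA.resolvent_directSumOperator_apply (hB := hB) hρ0 hρ1 hBρ hz
    (lp.single 2 k x) k
  rw [lp.single_apply_self, hk] at hcoord
  rw [← hcoord]
  refine (lp.norm_apply_le_norm two_ne_zero _ k).trans ?_
  refine (ContinuousLinearMap.le_opNorm _ _).trans_eq ?_
  rw [lp.norm_single (by norm_num)]

/-- The supremum need not be attained: for each `q < t` one nonzero coordinate with `q < ρ k`
already grows faster than rate `q`. -/
theorem localPower_directSumOperator (hA : IsHarmonicShift e A)
    (hρ0 : ∀ k, 0 < ρ k) (hρ1 : ∀ k, ρ k ≤ 1) (hBρ : ∀ k, B k = (ρ k : ℂ) • A)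
    (hone : ∃ k, ρ k = 1) {x : lp (fun _ : ℕ => H) 2} {t : ℝ}
    (ht : IsLUB (ρ '' {k | x k ≠ 0}) t) (hx : x ≠ 0) :
    localPower (directSumOperator B hB) x = t := by
  obtain ⟨k₀, hk₀⟩ : ∃ k, x k ≠ 0 := by
    by_contra! h
    exact hx (by ext k; simp [h k])
  have ht0 : 0 < t := (hρ0 k₀).trans_le (ht.1 ⟨k₀, hk₀, rfl⟩)
  rw [localPower_eq_div one_pos ht0 (norm_pos_iff.2 hx)
    (hA.tendsto_norm_mul_log_norm_resolvent_directSumOperator hρ0 hρ1 hBρ hone) ?_ ?_, div_one]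
  · filter_upwards [self_mem_nhdsWithin] with z hz
    rw [zpow_neg_one, mul_assoc, mul_comm]
    refine lp.norm_le_mul_norm_of_forall_le (by positivity) fun k => ?_
    rw [hA.resolvent_directSumOperator_apply hρ0 hρ1 hBρ hz]
    by_cases hk : x k = 0
    · simp [hk]
    · refine (ContinuousLinearMap.le_of_opNorm_le _
        (hA.norm_resolvent_smul_le (hρ0 k).le hz) _).trans ?_
      gcongr
      exact ht.1 ⟨k, hk, rfl⟩
  · intro q hq
    obtain ⟨_, ⟨k, hk, rfl⟩, hqk⟩ := (lt_isLUB_iff ht).1 hq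
    refine ((hA.frequently_lt_norm_mul_log_norm_resolvent_apply (hρ0 k) hk hqk).and_eventually
      self_mem_nhdsWithin).mono ?_
    rintro z ⟨⟨hpos, hlt⟩, hz⟩
    refine hlt.trans_le ?_
    rw [← hA.resolvent_directSumOperator_apply (hB := hB) hρ0 hρ1 hBρ hz] at hpos ⊢
    gcongr
    exact lp.norm_apply_le_norm two_ne_zero _ k

theorem operatorPowerSet_directSumOperator (hA : IsHarmonicShift e A)
    (hρ0 : ∀ k, 0 < ρ k) (hρ1 : ∀ k, ρ k ≤ 1) (hBρ : ∀ k, B k = (ρ k : ℂ) • A)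
    (hone : ∃ k, ρ k = 1) (hdense : ∀ a b : ℝ, 0 ≤ a → a < b → b ≤ 1 → ∃ k, a < ρ k ∧ ρ k < b) :
    operatorPowerSet (directSumOperator B hB) = Set.Ioc 0 1 := by
  ext t
  constructor
  · rintro ⟨x, hx, rfl⟩
    obtain ⟨k, hk⟩ : ∃ k, x k ≠ 0 := by
      by_contra! h
      exact hx (by ext k; simp [h k])
    have hub : (1 : ℝ) ∈ upperBounds (ρ '' {k | x k ≠ 0}) := by
      rintro _ ⟨j, -, rfl⟩; exact hρ1 j
    have hlub := isLUB_csSup (Set.Nonempty.image ρ ⟨k, hk⟩) ⟨1, hub⟩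
    rw [hA.localPower_directSumOperator hρ0 hρ1 hBρ hone hlub hx]
    exact ⟨(hρ0 k).trans_le (hlub.1 ⟨k, hk, rfl⟩), hlub.2 hub⟩
  · rintro ⟨ht0, ht1⟩
    -- Supporting `x` on all weights up to `t` makes their supremum `t`, even for irrational `t`.
    obtain ⟨x, hx⟩ := e.exists_lp_support_eq {k | ρ k ≤ t}
    have hlub : IsLUB (ρ '' {k | x k ≠ 0}) t := by
      rw [hx]
      refine ⟨by rintro _ ⟨k, hk, rfl⟩; exact hk, fun b hb => ?_⟩
      by_contra! hbt
      -- An upper bound `b` might be negative, whereas `hdense` needs a nonnegative left endpoint.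
      obtain ⟨k, hk1, hk2⟩ := hdense (max b 0) t (le_max_right _ _) (max_lt hbt ht0) ht1
      exact (hb ⟨k, hk2.le, rfl⟩).not_gt ((le_max_left _ _).trans_lt hk1)
    obtain ⟨k, -, hk⟩ := hdense 0 t le_rfl ht0 ht1
    have hxne : x ≠ 0 := by
      rintro rfl
      have : k ∈ {k | (0 : lp (fun _ : ℕ => H) 2) k ≠ 0} := by rw [hx]; exact hk.le
      simp at this
    exact ⟨x, hxne, hA.localPower_directSumOperator hρ0 hρ1 hBρ hone hlub hxne⟩

end IsHarmonicShift

end DirectSum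

theorem exists_enumeration_rat_Ioc :
    ∃ r : ℕ → ℚ, Function.Injective r ∧ Set.range r = Set.Ioc 0 1 := by
  have : Infinite (Set.Ioc (0 : ℚ) 1) := (Set.Ioc_infinite one_pos).to_subtype
  obtain ⟨f⟩ := nonempty_equiv_of_countable (α := ℕ) (β := Set.Ioc (0 : ℚ) 1)
  refine ⟨fun n => f n, Subtype.val_injective.comp f.injective, ?_⟩
  change Set.range (Subtype.val ∘ f) = _
  rw [f.surjective.range_comp, Subtype.range_coe]

theorem mainTheorem6 {H : Type*} [NormedAddCommGroup H] [InnerProductSpace ℂ H]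
    [CompleteSpace H] [TopologicalSpace.SeparableSpace H] (hH : ¬ FiniteDimensional ℂ H) :
    -- the weighted shift `A` with weights `1, 1/2, 1/3, …` in an orthonormal basis `e` of `H`,
    -- and an enumeration `r` of the rationals in `(0, 1]`
    ∃ (e : HilbertBasis ℕ ℂ H) (A : H →L[ℂ] H) (r : ℕ → ℚ) (B : ℕ → H →L[ℂ] H),
      (∀ n : ℕ, A (e n) = (1 / ((n : ℂ) + 1)) • e (n + 1)) ∧
      Function.Injective r ∧ Set.range r = Set.Ioc 0 1 ∧
      (∀ k, B k = (r k : ℂ) • A) ∧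
      (∀ k, IsQuasinilpotent (B k)) ∧
      (∀ k, operatorPowerSet (B k) = {1}) ∧
      ∃ hB : BddAbove (Set.range fun k => ‖B k‖),
        IsQuasinilpotent (directSumOperator B hB) ∧
        operatorPowerSet (directSumOperator B hB) = Set.Ioc 0 1 ∧
        closure (⋃ k, operatorPowerSet (B k)) ⊂ operatorPowerSet (directSumOperator B hB) := by
  obtain ⟨e⟩ := exists_hilbertBasis_nat hH
  obtain ⟨A, hA⟩ := exists_isHarmonicShift e
  obtain ⟨r, hr, hrange⟩ := exists_enumeration_rat_Ioc
  have hmem : ∀ k, r k ∈ Set.Ioc (0 : ℚ) 1 := fun k => hrange ▸ Set.mem_range_self k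
  have hρ0 : ∀ k, (0 : ℝ) < r k := fun k => by exact_mod_cast (hmem k).1
  have hρ1 : ∀ k, (r k : ℝ) ≤ 1 := fun k => by exact_mod_cast (hmem k).2
  have hsurj : ∀ q ∈ Set.Ioc (0 : ℚ) 1, ∃ k, r k = q := fun q hq => by rwa [← hrange] at hq
  let B : ℕ → H →L[ℂ] H := fun k => (r k : ℂ) • A
  have hBρ : ∀ k, B k = (((r k : ℚ) : ℝ) : ℂ) • A := fun k => by simp [B]
  have hΛ : ∀ k, operatorPowerSet (B k) = {1} := fun k => by
    rw [hBρ]; exact hA.operatorPowerSet_smul (hρ0 k)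
  have hB : BddAbove (Set.range fun k => ‖B k‖) := by
    refine ⟨1, ?_⟩
    rintro _ ⟨k, rfl⟩
    have h := hA.norm_smul_pow_le (hρ0 k).le 1
    simp only [pow_one, Nat.factorial_one, Nat.cast_one, div_one, ← hBρ] at h
    exact h.trans (hρ1 k)
  have hone : ∃ k, ((r k : ℚ) : ℝ) = 1 := by
    obtain ⟨k, hk⟩ := hsurj 1 ⟨one_pos, le_rfl⟩
    exact ⟨k, by simp [hk]⟩
  have hdense : ∀ a b : ℝ, 0 ≤ a → a < b → b ≤ 1 → ∃ k, a < (r k : ℝ) ∧ (r k : ℝ) < b := by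
    intro a b ha hab hb
    obtain ⟨q, hq1, hq2⟩ := exists_rat_btwn hab
    obtain ⟨k, rfl⟩ := hsurj q
      ⟨by exact_mod_cast ha.trans_lt hq1, by exact_mod_cast (hq2.trans_le hb).le⟩
    exact ⟨k, hq1, hq2⟩
  have hsum : operatorPowerSet (directSumOperator B hB) = Set.Ioc 0 1 :=
    hA.operatorPowerSet_directSumOperator hρ0 hρ1 hBρ hone hdense
  refine ⟨e, A, r, B, hA, hr, hrange, fun _ => rfl, fun k => ?_, hΛ, hB,
    hA.isQuasinilpotent_directSumOperator hρ0 hρ1 hBρ, hsum, ?_⟩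
  · rw [hBρ]; exact hA.isQuasinilpotent_smul (hρ0 k).le
  · simp only [hsum, hΛ, Set.iUnion_const, closure_singleton]
    refine (Set.ssubset_iff_of_subset (Set.singleton_subset_iff.2 (Set.right_mem_Ioc.2 one_pos))).2
      ⟨1 / 2, ⟨by norm_num, by norm_num⟩, by norm_num⟩
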